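/- Let $N$ be a smooth $4$-manifold (Hausdorff, second countable) and let $\kappa\in\Omega^2_2(N)$ be a smooth real $\binom22$-tensor field on $N$, antisymmetric in its two upper and in its two lower indices. We regard $\kappa$ as a linear operator on $2$-forms: in local coordinates, with components $\kappa^{ij}_{lm}$, it maps $F=F_{ij}\,dx^i\otimes dx^j$ to the $2$-form with components $(\kappa F)_{ij}=\tfrac12\kappa^{rs}_{ij}F_{rs}$. Let $\operatorname{Id}$ be the tensor of the identity operator, and let $\det\kappa$ and $\kappa^{-1}$ be the pointwise determinant and (when $\kappa$ is pointwise invertible) the inverse of this operator on the $6$-dimensional spaces $\Lambda^2_p(N)$. Every $\kappa$ decomposes uniquely as $\kappa={}^{(1)}\kappa+{}^{(2)}\kappa+{}^{(3)}\kappa$, where $u\wedge{}^{(1)}\kappa(v)={}^{(1)}\kappa(u)\wedge v$ for all $2$-forms $u,v$ and $\operatorname{trace}{}^{(1)}\kappa=0$; $u\wedge{}^{(2)}\kappa(v)=-{}^{(2)}\kappa(u)\wedge v$ for all $2$-forms $u,v$; and ${}^{(3)}\kappa=f\operatorname{Id}$ for some $f\in C^\infty(N)$. The tensor ${}^{(2)}\kappa$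 is called the skewon part of $\kappa$. The Tamm–Rubilar tensor density $\mathcal G(\kappa)$ is the tensor density of weight $1$ whose components $\mathcal G^{ijkl}$ in local coordinates are the symmetrisation $\mathcal G_0^{(ijkl)}$ (with factor $1/4!$) of $$\mathcal G_0^{ijkl}=\tfrac1{48}\,\kappa^{a_1a_2}_{b_1b_2}\,\kappa^{a_3i}_{b_3b_4}\,\kappa^{a_4j}_{b_5b_6}\,\varepsilon^{b_1b_2b_5k}\,\varepsilon^{b_3b_4b_6l}\,\varepsilon_{a_1a_2a_3a_4},$$ where $\varepsilon$ is the Levi-Civita permutation symbol and repeated indices are summed. The Fresnel surface of $\kappa$ at $p\in N$ is $F_p(\kappa)=\{\xi\in T^*_pN:\mathcal G^{ijkl}\xi_i\xi_j\xi_k\xi_l=0\}$. Then: (i) $\mathcal G(f\kappa)=f^3\,\mathcal G(\kappa)$ for all $f\in C^\infty(N)$; (ii) $\mathcal G({}^{(2)}\kappa)=0$; (iii) $\mathcal G(\kappa)=\mathcal G(\kappa+f\operatorname{Id})$ for all $f\in C^\infty(N)$; (iv) if $\kappa$ is invertible at every point, then $\mathcal G(\kappa^{-1})=\mathcal G\bigl(-(\det\kappa)^{-1/3}\kappa\bigr)$,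 where $(\det\kappa)^{-1/3}$ is the inverse of the real cube root of $\det\kappa$ (negative where $\det\kappa<0$). Hence $F_p(\kappa^{-1})=F_p(\kappa)$ for every $p\in N$. -/

import Mathlib

open scoped Manifold ContDiff

noncomputable section

namespace TammRubilar

/-! Conventions.  `N` is a smooth 4-manifold modelled on `EuclideanSpace ℝ (Fin 4)`; coordinates
are numbered `0, 1, 2, 3`. -/

/-- The model space `ℝ⁴`. -/
abbrev E4 : Type := EuclideanSpace ℝ (Fin 4)

/-- The combinatorial Levi-Civita symbol on four indices: the sign of the permutation
`(0,1,2,3) ↦ (i,j,k,l)` if this is a permutation, and `0` otherwise. -/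
def leviCivita (i j k l : Fin 4) : ℝ :=
  ∑ σ : Equiv.Perm (Fin 4), if ⇑σ = ![i, j, k, l] then ((Equiv.Perm.sign σ : ℤ) : ℝ) else 0

/-- The real number `x ^ (-1/3)`, that is, the inverse of the real cube root of `x`
(negative when `x` is negative). -/
def invCbrt (x : ℝ) : ℝ := Real.sign x * |x| ^ (-(1 / 3) : ℝ)

/-- For `x ≠ 0`, `invCbrt x` is the unique real number whose cube is `x⁻¹`. -/
theorem invCbrt_pow_three (x : ℝ) (hx : x ≠ 0) : invCbrt x ^ 3 = x⁻¹ := by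
  have h1 : (|x| ^ (-(1 / 3) : ℝ)) ^ 3 = |x|⁻¹ := by
    rw [← Real.rpow_natCast, ← Real.rpow_mul (abs_nonneg x)]
    norm_num [Real.rpow_neg_one]
  rw [invCbrt, mul_pow, h1]
  rcases lt_or_gt_of_ne hx with h | h
  · rw [Real.sign_of_neg h, abs_of_neg h, inv_neg]; ring
  · rw [Real.sign_of_pos h, abs_of_pos h]; ring

section Algebra

variable {V : Type*} [AddCommGroup V] [Module ℝ V]

/-- The 2-form `α ∧ β = α ⊗ β - β ⊗ α` of two covectors. -/
def wedgeOne (α β : V →ₗ[ℝ] ℝ) : V [⋀^Fin 2]→ₗ[ℝ] ℝ :=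
  MultilinearMap.alternatization
    ((MultilinearMap.mkPiAlgebra ℝ (Fin 2) ℝ).compLinearMap ![α, β])

theorem wedgeOne_apply (α β : V →ₗ[ℝ] ℝ) (v w : V) :
    wedgeOne α β ![v, w] = α v * β w - α w * β v := by
  have h : (Finset.univ : Finset (Equiv.Perm (Fin 2))) = {1, Equiv.swap 0 1} := by decide
  simp [wedgeOne, MultilinearMap.alternatization_apply, Fin.prod_univ_two, h,
    Finset.sum_pair (show (1 : Equiv.Perm (Fin 2)) ≠ Equiv.swap 0 1 by decide)]
  ring

/-- The wedge product of two 2-forms, a 4-form: the sum over all shuffles (hence no numerical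
factor), with values multiplied in `ℝ`. -/
def wedgeTwo (u v : V [⋀^Fin 2]→ₗ[ℝ] ℝ) : V [⋀^Fin 2 ⊕ Fin 2]→ₗ[ℝ] ℝ :=
  (LinearMap.mul' ℝ ℝ).compAlternatingMap (u.domCoprod v)

end Algebra

section Fields

variable (N : Type*) [TopologicalSpace N] [ChartedSpace E4 N]

/-- Smooth local coordinates on `N`: a chart of the maximal smooth atlas. -/
abbrev SmoothChart : Type _ :=
  {φ : OpenPartialHomeomorph N E4 // φ ∈ IsManifold.maximalAtlas (𝓡 4) ∞ N}

variable {N}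

/-- The cotangent space `Λ¹_p(N)`. -/
abbrev Covector (p : N) : Type := TangentSpace (𝓡 4) p →ₗ[ℝ] ℝ

/-- The space `Λ²_p(N)` of 2-covectors at `p`. -/
abbrev TwoCovector (p : N) : Type := TangentSpace (𝓡 4) p [⋀^Fin 2]→ₗ[ℝ] ℝ

/-- The coordinate covector `dx^i|_p`. -/
def coframe (φ : SmoothChart N) (p : N) (i : Fin 4) : Covector p :=
  (EuclideanSpace.proj i : E4 →L[ℝ] ℝ).toLinearMap ∘ₗ
    (mfderiv (𝓡 4) 𝓘(ℝ, E4) φ.1 p : TangentSpace (𝓡 4) p →L[ℝ] E4).toLinearMap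

/-- The coordinate vector `∂/∂x^i|_p`: the tangent vector which the derivative of the coordinate
map sends to the `i`th standard basis vector. -/
def frame (φ : SmoothChart N) (p : N) (i : Fin 4) : TangentSpace (𝓡 4) p :=
  (mfderiv (𝓡 4) 𝓘(ℝ, E4) φ.1 p : TangentSpace (𝓡 4) p →L[ℝ] E4).inverse
    (EuclideanSpace.single i 1)

variable (N) in
/-- A (not necessarily smooth) field of antisymmetric (2,2)-tensors on `N`, regarded as the
pointwise linear operator on 2-forms `(κ F)_{ij} = ½ κ^{rs}_{ij} F_{rs}`.  Antisymmetric
(2,2)-tensors at `p` are the elements of `Λ²T_p ⊗ Λ²T_p^*`, and these are the same as the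
endomorphisms of `Λ²_p(N)`.  The unit `1` is the tensor `Id`, with components
`δ^i_r δ^j_s - δ^i_s δ^j_r`. -/
abbrev TensorField22 : Type _ := ∀ p : N, Module.End ℝ (TwoCovector p)

/-- The components `κ^{ij}_{lm}` of `κ` in the coordinates `φ`:
`κ (dx^i ∧ dx^j) = ½ κ^{ij}_{lm} dx^l ∧ dx^m`. -/
def comp (κ : TensorField22 N) (φ : SmoothChart N) (p : N) (i j l m : Fin 4) : ℝ :=
  κ p (wedgeOne (coframe φ p i) (coframe φ p j)) ![frame φ p l, frame φ p m]

/-- Smoothness of a tensor field: the components in all coordinates are smooth.  The set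
`Ω²₂(N)` consists of the `κ : TensorField22 N` with `IsSmooth κ`. -/
def IsSmooth (κ : TensorField22 N) : Prop :=
  ∀ (φ : SmoothChart N) (i j l m : Fin 4),
    ContMDiffOn (𝓡 4) 𝓘(ℝ, ℝ) ∞ (fun p => comp κ φ p i j l m) φ.1.source

/-- Pure principal part: `u ∧ κ(v) = κ(u) ∧ v` for all 2-forms, and `trace κ = 0`. -/
def IsPrincipal (κ : TensorField22 N) : Prop :=
  IsSmooth κ ∧
  (∀ (p : N) (u v : TwoCovector p), wedgeTwo u (κ p v) = wedgeTwo (κ p u) v) ∧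
  ∀ p : N, LinearMap.trace ℝ (TwoCovector p) (κ p) = 0

/-- Pure skewon: `u ∧ κ(v) = -κ(u) ∧ v` for all 2-forms. -/
def IsSkewon (κ : TensorField22 N) : Prop :=
  IsSmooth κ ∧
  ∀ (p : N) (u v : TwoCovector p), wedgeTwo u (κ p v) = -wedgeTwo (κ p u) v

/-- Pure axion: `κ = f Id` for a smooth function `f`. -/
def IsAxion (κ : TensorField22 N) : Prop :=
  ∃ f : N → ℝ, ContMDiff (𝓡 4) 𝓘(ℝ, ℝ) ∞ f ∧ κ = fun p => f p • 1

/-- `σ` is the skewon part of `κ`: the skewon summand in the decomposition of `κ` into a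
principal, a skewon and an axion tensor. -/
def IsSkewonPart (σ κ : TensorField22 N) : Prop :=
  IsSkewon σ ∧ ∃ π α : TensorField22 N, IsPrincipal π ∧ IsAxion α ∧ κ = π + σ + α

/-- Invertible (2,2)-tensors: pointwise invertible as operators on 2-forms. -/
def Invertible (κ : TensorField22 N) : Prop := ∀ p : N, IsUnit (κ p)

/-- The inverse tensor `κ⁻¹`, pointwise the inverse linear map (meaningful for invertible `κ`). -/
def inv (κ : TensorField22 N) : TensorField22 N := fun p => Ring.inverse (κ p)

/-- `det κ`, the determinant of the linear map `κ_p` of the 6-dimensional space `Λ²_p(N)`. -/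
def det (κ : TensorField22 N) (p : N) : ℝ := LinearMap.det (κ p)

variable (N) in
/-- Systems of components `T^{ijkl}` of objects with four upper indices, one system for each
smooth coordinate chart and each point of the domain of that chart. A tensor density is given
by such a system, and two tensor densities are equal when all their components are equal. -/
abbrev Components40 : Type _ :=
  ∀ φ : SmoothChart N, φ.1.source → Fin 4 → Fin 4 → Fin 4 → Fin 4 → ℝ

/-- The components `G₀^{ijkl} = (1/48) κ^{a₁a₂}_{b₁b₂} κ^{a₃i}_{b₃b₄} κ^{a₄j}_{b₅b₆}
ε^{b₁b₂b₅k} ε^{b₃b₄b₆l} ε_{a₁a₂a₃a₄}`, summed over `a₁,…,a₄,b₁,…,b₆`. -/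
def G₀ (κ : TensorField22 N) : Components40 N := fun φ p i j k l =>
  (1 / 48) * ∑ a : Fin 4 → Fin 4, ∑ b : Fin 6 → Fin 4,
    comp κ φ p (a 0) (a 1) (b 0) (b 1) *
    comp κ φ p (a 2) i (b 2) (b 3) *
    comp κ φ p (a 3) j (b 4) (b 5) *
    leviCivita (b 0) (b 1) (b 4) k *
    leviCivita (b 2) (b 3) (b 5) l *
    leviCivita (a 0) (a 1) (a 2) (a 3)

/-- The Tamm–Rubilar tensor density of `κ`: the symmetrisation `G^{ijkl} = G₀^{(ijkl)}`,
with scaling `1/4!`. -/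
def G (κ : TensorField22 N) : Components40 N := fun φ p i j k l =>
  (1 / 24) * ∑ σ : Equiv.Perm (Fin 4),
    G₀ κ φ p (![i, j, k, l] (σ 0)) (![i, j, k, l] (σ 1)) (![i, j, k, l] (σ 2))
      (![i, j, k, l] (σ 3))

/-- The product of a function and a tensor density. -/
def fsmul (f : N → ℝ) (T : Components40 N) : Components40 N :=
  fun φ p i j k l => f p * T φ p i j k l

/-- The Fresnel surface of `κ` at `p`: the covectors `ξ = ξ_i dx^i` at `p` with
`G^{ijkl} ξ_i ξ_j ξ_k ξ_l = 0` (in all coordinates around `p`). -/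
def fresnel (κ : TensorField22 N) (p : N) : Set (Covector p) :=
  {ξ | ∀ (φ : SmoothChart N) (hp : p ∈ φ.1.source),
    ∑ i, ∑ j, ∑ k, ∑ l, G κ φ ⟨p, hp⟩ i j k l *
      (ξ (frame φ p i) * ξ (frame φ p j) * ξ (frame φ p k) * ξ (frame φ p l)) = 0}

end Fields

end TammRubilar

end

noncomputable section

namespace TammRubilar

open Module

/-! The whole theorem is about one 3×3 determinant. A symmetric 4-tensor is determined by its
quartic form, so at each point it suffices to compare the values of the quartic at every covector ξ
(`symmetrization_eq_zero`, `sum_polarForm_eq`). Contracted with ξ in all four slots, `G₀` becomes a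
triple antisymmetrization, one over covectors and two over vectors (`polarForm_self`). A change of
basis therefore multiplies it only by determinants that do not involve κ (`cubicSum_basis`).

For ξ ≠ 0, choose a basis with e⁰ = ξ. The quartic is then, up to such a factor, det B, where B is
the block of κ from ξ ∧ V* to Λ² modulo ξ ∧ V* (`cubicSum_coord_zero`, `exists_cubicSum_eq`).

The claims become linear algebra. Scaling κ by f scales det B by f³. Adding a multiple of the
identity leaves B unchanged. For a skewon, B is antisymmetric of odd size, so det B = 0
(`det_offBlock_of_skew`). For the inverse, Jacobi's complementary minor identity gives -det B / det
κ (`det_offBlock_inverse`), and the cube root turns this factor into a rescaling of κ.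
`G_eq_mul_of_det_offBlock` carries each relation between determinants over to the densities. -/

/-! ### Sums over permutations of four letters; polarization -/

theorem sum_leviCivita_mul (F : (Fin 4 → Fin 4) → ℝ) :
    ∑ a : Fin 4 → Fin 4, leviCivita (a 0) (a 1) (a 2) (a 3) * F a
      = ∑ σ : Equiv.Perm (Fin 4), ((Equiv.Perm.sign σ : ℤ) : ℝ) * F σ := by
  simp only [leviCivita, Finset.sum_mul]
  rw [Finset.sum_comm]
  refine Finset.sum_congr rfl fun σ _ => ?_
  have h : ∀ a : Fin 4 → Fin 4, ![a 0, a 1, a 2, a 3] = a := fun a => by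
    ext i; fin_cases i <;> rfl
  simp [h, ite_mul]

/-- The terms of a sum over the permutations of four letters, grouped by the image of `0`. -/
theorem sum_perm_four {M : Type*} [AddCommMonoid M] (F : Equiv.Perm (Fin 4) → M) :
    ∑ σ, F σ = ∑ p : Fin 4, ∑ q : Fin 3, ∑ r : Fin 2,
      F (Equiv.Perm.decomposeFin.symm (p, Equiv.Perm.decomposeFin.symm
        (q, Equiv.Perm.decomposeFin.symm (r, 1)))) := by
  simp only [← (Equiv.Perm.decomposeFin (n := 3)).symm.sum_comp,
    ← (Equiv.Perm.decomposeFin (n := 2)).symm.sum_comp,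
    ← (Equiv.Perm.decomposeFin (n := 1)).symm.sum_comp, Fintype.sum_prod_type]
  simp

/-- An explicit table of the 24 permutations; with the sign table below it, signed sums expand into
terms with literal indices. -/
theorem coe_decomposeFin_symm (p : Fin 4) (q : Fin 3) (r : Fin 2) :
    ⇑(Equiv.Perm.decomposeFin.symm (p, Equiv.Perm.decomposeFin.symm
        (q, Equiv.Perm.decomposeFin.symm (r, (1 : Equiv.Perm (Fin 1))))))
      = (![![![![0, 1, 2, 3], ![0, 1, 3, 2]], ![![0, 2, 1, 3], ![0, 2, 3, 1]], ![![0, 3, 2, 1], ![0, 3, 1, 2]]],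
          ![![![1, 0, 2, 3], ![1, 0, 3, 2]], ![![1, 2, 0, 3], ![1, 2, 3, 0]], ![![1, 3, 2, 0], ![1, 3, 0, 2]]],
          ![![![2, 1, 0, 3], ![2, 1, 3, 0]], ![![2, 0, 1, 3], ![2, 0, 3, 1]], ![![2, 3, 0, 1], ![2, 3, 1, 0]]],
          ![![![3, 1, 2, 0], ![3, 1, 0, 2]], ![![3, 2, 1, 0], ![3, 2, 0, 1]], ![![3, 0, 2, 1], ![3, 0, 1, 2]]]] : Fin 4 → Fin 3 → Fin 2 → Fin 4 → Fin 4) p q r := by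
  decide +revert

theorem sign_decomposeFin_symm (p : Fin 4) (q : Fin 3) (r : Fin 2) :
    ((Equiv.Perm.sign (Equiv.Perm.decomposeFin.symm (p, Equiv.Perm.decomposeFin.symm
        (q, Equiv.Perm.decomposeFin.symm (r, (1 : Equiv.Perm (Fin 1)))))) : ℤ))
      = (![1, -1, -1, -1] : Fin 4 → ℤ) p * (![1, -1, -1] : Fin 3 → ℤ) q
        * (![1, -1] : Fin 2 → ℤ) r := by
  decide +revert

theorem sum_sign_mul_perm_four (g : Fin 4 → Fin 4 → Fin 4 → Fin 4 → ℝ) :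
    ∑ σ : Equiv.Perm (Fin 4), ((Equiv.Perm.sign σ : ℤ) : ℝ) * g (σ 0) (σ 1) (σ 2) (σ 3)
      = g 0 1 2 3 - g 0 1 3 2 - g 0 2 1 3 + g 0 2 3 1 + g 0 3 1 2 - g 0 3 2 1
      - g 1 0 2 3 + g 1 0 3 2 + g 1 2 0 3 - g 1 2 3 0 - g 1 3 0 2 + g 1 3 2 0
      + g 2 0 1 3 - g 2 0 3 1 - g 2 1 0 3 + g 2 1 3 0 + g 2 3 0 1 - g 2 3 1 0
      - g 3 0 1 2 + g 3 0 2 1 + g 3 1 0 2 - g 3 1 2 0 - g 3 2 0 1 + g 3 2 1 0 := by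
  rw [sum_perm_four]
  simp only [sign_decomposeFin_symm, coe_decomposeFin_symm]
  simp only [Fin.sum_univ_four, Fin.sum_univ_three, Fin.sum_univ_two, Fin.isValue,
    Matrix.cons_val]
  push_cast
  ring

theorem sum_perm_four_apply (g : Fin 4 → Fin 4 → Fin 4 → Fin 4 → ℝ) :
    ∑ σ : Equiv.Perm (Fin 4), g (σ 0) (σ 1) (σ 2) (σ 3)
      = g 0 1 2 3 + g 0 1 3 2 + g 0 2 1 3 + g 0 2 3 1 + g 0 3 1 2 + g 0 3 2 1
      + g 1 0 2 3 + g 1 0 3 2 + g 1 2 0 3 + g 1 2 3 0 + g 1 3 0 2 + g 1 3 2 0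
      + g 2 0 1 3 + g 2 0 3 1 + g 2 1 0 3 + g 2 1 3 0 + g 2 3 0 1 + g 2 3 1 0
      + g 3 0 1 2 + g 3 0 2 1 + g 3 1 0 2 + g 3 1 2 0 + g 3 2 0 1 + g 3 2 1 0 := by
  rw [sum_perm_four]
  simp only [coe_decomposeFin_symm]
  simp only [Fin.sum_univ_four, Fin.sum_univ_three, Fin.sum_univ_two, Fin.isValue,
    Matrix.cons_val]
  ring

/-- Polarization: the symmetrization of a 4-additive function vanishes if its diagonal does. -/
theorem symmetrization_eq_zero {M : Type*} [AddCommGroup M] (P : M → M → M → M → ℝ)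
    (h₁ : ∀ x x' y z w, P (x + x') y z w = P x y z w + P x' y z w)
    (h₂ : ∀ x y y' z w, P x (y + y') z w = P x y z w + P x y' z w)
    (h₃ : ∀ x y z z' w, P x y (z + z') w = P x y z w + P x y z' w)
    (h₄ : ∀ x y z w w', P x y z (w + w') = P x y z w + P x y z w')
    (h : ∀ x, P x x x x = 0) (u : Fin 4 → M) :
    ∑ σ : Equiv.Perm (Fin 4), P (u (σ 0)) (u (σ 1)) (u (σ 2)) (u (σ 3)) = 0 := by
  rw [sum_perm_four_apply fun i j k l => P (u i) (u j) (u k) (u l)]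
  generalize u 0 = x, u 1 = y, u 2 = z, u 3 = w
  -- Inclusion–exclusion over nonempty subsets of the four arguments; the singletons already vanish
  -- by `h`.
  have e4 := h (x + y + z + w)
  have e30 := h (x + y + z)
  have e31 := h (x + y + w)
  have e32 := h (x + z + w)
  have e33 := h (y + z + w)
  have e20 := h (x + y)
  have e21 := h (x + z)
  have e22 := h (x + w)
  have e23 := h (y + z)
  have e24 := h (y + w)
  have e25 := h (z + w)
  simp only [h₁, h₂, h₃, h₄, h] at e4 e30 e31 e32 e33 e20 e21 e22 e23 e24 e25
  linear_combination e4 - e30 - e31 - e32 - e33 + e20 + e21 + e22 + e23 + e24 + e25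

/-- Change of basis in the total antisymmetrization of a multilinear map. -/
theorem sum_sign_mul_basis {W : Type*} [AddCommGroup W] [Module ℝ W]
    (M : MultilinearMap ℝ (fun _ : Fin 4 => W) ℝ) (e e' : Basis (Fin 4) ℝ W) :
    ∑ σ : Equiv.Perm (Fin 4), ((Equiv.Perm.sign σ : ℤ) : ℝ) * M (fun i => e (σ i))
      = e'.det e *
        ∑ σ : Equiv.Perm (Fin 4), ((Equiv.Perm.sign σ : ℤ) : ℝ) * M (fun i => e' (σ i)) := by
  -- A top-degree alternating form is a multiple of the determinant, the multiple being its value on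
  -- `e'`.
  have h := congrArg (fun f => f e) ((MultilinearMap.alternatization M).eq_smul_basis_det e')
  simp only [AlternatingMap.smul_apply, MultilinearMap.alternatization_apply,
    MultilinearMap.domDomCongr_apply, smul_eq_mul] at h
  simp only [Units.smul_def, zsmul_eq_mul] at h
  rw [h, mul_comm]

theorem vec_two_eta {W : Type*} (v : Fin 2 → W) : ![v 0, v 1] = v := by
  ext i; fin_cases i <;> rfl

/-! ### Bilinear calculus of 2-forms -/

section Forms

variable {V : Type*} [AddCommGroup V] [Module ℝ V]

theorem twoForm_swap (u : V [⋀^Fin 2]→ₗ[ℝ] ℝ) (v w : V) : u ![v, w] = -u ![w, v] := by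
  have h := u.map_swap ![w, v] (show (0 : Fin 2) ≠ 1 by decide)
  rw [← h]
  congr 1
  ext i
  fin_cases i <;> rfl

theorem twoForm_self (u : V [⋀^Fin 2]→ₗ[ℝ] ℝ) (v : V) : u ![v, v] = 0 :=
  u.map_eq_zero_of_eq _ (i := 0) (j := 1) rfl (by decide)

theorem twoForm_ext {u u' : V [⋀^Fin 2]→ₗ[ℝ] ℝ} (h : ∀ v w, u ![v, w] = u' ![v, w]) : u = u' := by
  ext v
  rw [← vec_two_eta v, h]

theorem wedgeOne_add_left (α α' β : V →ₗ[ℝ] ℝ) :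
    wedgeOne (α + α') β = wedgeOne α β + wedgeOne α' β :=
  twoForm_ext fun v w => by
    simp only [AlternatingMap.add_apply, wedgeOne_apply, LinearMap.add_apply]; ring

theorem wedgeOne_smul_left (c : ℝ) (α β : V →ₗ[ℝ] ℝ) :
    wedgeOne (c • α) β = c • wedgeOne α β :=
  twoForm_ext fun v w => by
    simp only [AlternatingMap.smul_apply, wedgeOne_apply, LinearMap.smul_apply, smul_eq_mul]; ring

theorem wedgeOne_swap (α β : V →ₗ[ℝ] ℝ) : wedgeOne α β = -wedgeOne β α :=
  twoForm_ext fun v w => by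
    simp only [AlternatingMap.neg_apply, wedgeOne_apply]; ring

theorem wedgeOne_add_right (α β β' : V →ₗ[ℝ] ℝ) :
    wedgeOne α (β + β') = wedgeOne α β + wedgeOne α β' := by
  rw [wedgeOne_swap, wedgeOne_add_left, neg_add, ← wedgeOne_swap, ← wedgeOne_swap]

theorem wedgeOne_smul_right (c : ℝ) (α β : V →ₗ[ℝ] ℝ) :
    wedgeOne α (c • β) = c • wedgeOne α β :=
  twoForm_ext fun v w => by
    simp only [AlternatingMap.smul_apply, wedgeOne_apply, LinearMap.smul_apply, smul_eq_mul]; ring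

theorem wedgeOne_self (α : V →ₗ[ℝ] ℝ) : wedgeOne α α = 0 :=
  twoForm_ext fun v w => by
    simp only [AlternatingMap.zero_apply, wedgeOne_apply]; ring

theorem twoForm_add_left (u : V [⋀^Fin 2]→ₗ[ℝ] ℝ) (v v' w : V) :
    u ![v + v', w] = u ![v, w] + u ![v', w] := by
  have h := u.map_update_add ![v, w] 0 v v'
  simp only [Matrix.vecCons, Fin.update_cons_zero] at h
  exact h

theorem twoForm_smul_left (u : V [⋀^Fin 2]→ₗ[ℝ] ℝ) (c : ℝ) (v w : V) :
    u ![c • v, w] = c * u ![v, w] := by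
  have h := u.map_update_smul ![v, w] 0 c v
  simp only [Matrix.vecCons, Fin.update_cons_zero] at h
  exact h

theorem twoForm_add_right (u : V [⋀^Fin 2]→ₗ[ℝ] ℝ) (v w w' : V) :
    u ![v, w + w'] = u ![v, w] + u ![v, w'] := by
  rw [twoForm_swap, twoForm_add_left, twoForm_swap u v, twoForm_swap u v w']; ring

theorem twoForm_smul_right (u : V [⋀^Fin 2]→ₗ[ℝ] ℝ) (c : ℝ) (v w : V) :
    u ![v, c • w] = c * u ![v, w] := by
  rw [twoForm_swap, twoForm_smul_left, twoForm_swap u v]; ring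

/-! ### The quartic as a triple antisymmetrization -/

variable (V) in
/-- Four-slot real-valued forms with two covector and two vector arguments. -/
abbrev Form22 : Type _ :=
  (V →ₗ[ℝ] ℝ) →ₗ[ℝ] (V →ₗ[ℝ] ℝ) →ₗ[ℝ] V →ₗ[ℝ] V →ₗ[ℝ] ℝ

/-- The bilinear form underlying an alternating 2-form. -/
def twoFormBilin (u : V [⋀^Fin 2]→ₗ[ℝ] ℝ) : V →ₗ[ℝ] V →ₗ[ℝ] ℝ :=
  LinearMap.mk₂ ℝ (fun v w => u ![v, w]) (twoForm_add_left u) (twoForm_smul_left u)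
    (twoForm_add_right u) (fun c v w => twoForm_smul_right u c v w)

/-- The multilinear form `(α, β, v, w) ↦ A(α ∧ β)(v, w)` of an operator on 2-forms. -/
def operatorForm (A : End ℝ (V [⋀^Fin 2]→ₗ[ℝ] ℝ)) : Form22 V :=
  LinearMap.mk₂ ℝ (fun α β => twoFormBilin (A (wedgeOne α β)))
    (fun α α' β => by ext; simp [twoFormBilin, wedgeOne_add_left])
    (fun c α β => by ext; simp [twoFormBilin, wedgeOne_smul_left])
    (fun α β β' => by ext; simp [twoFormBilin, wedgeOne_add_right])
    (fun c α β => by ext; simp [twoFormBilin, wedgeOne_smul_right])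

@[simp]
theorem operatorForm_apply (A : End ℝ (V [⋀^Fin 2]→ₗ[ℝ] ℝ)) (α β : V →ₗ[ℝ] ℝ) (v w : V) :
    operatorForm A α β v w = A (wedgeOne α β) ![v, w] := rfl

/-- The integrand of the Tamm–Rubilar quartic, before antisymmetrization. -/
def cubicTerm (T : Form22 V) (ξ : V →ₗ[ℝ] ℝ) (e : Fin 4 → V →ₗ[ℝ] ℝ) (v w : Fin 4 → V) : ℝ :=
  T (e 0) (e 1) (v 0) (v 1) * T (e 2) ξ (w 0) (w 1) * T (e 3) ξ (v 2) (w 2) * ξ (v 3) * ξ (w 3)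

/-- `cubicTerm` as a multilinear map in the covectors. -/
def cubicTermCovectors (T : Form22 V) (ξ : V →ₗ[ℝ] ℝ) (v w : Fin 4 → V) :
    MultilinearMap ℝ (fun _ : Fin 4 => V →ₗ[ℝ] ℝ) ℝ :=
  MultilinearMap.mk' (fun e => cubicTerm T ξ e v w)
    (fun e i x y => by fin_cases i <;> simp [cubicTerm, Function.update] <;> ring)
    (fun e i c x => by fin_cases i <;> simp [cubicTerm, Function.update] <;> ring)

/-- `cubicTerm` as a multilinear map in the first group of vectors. -/
def cubicTermFst (T : Form22 V) (ξ : V →ₗ[ℝ] ℝ) (e : Fin 4 → V →ₗ[ℝ] ℝ) (w : Fin 4 → V) :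
    MultilinearMap ℝ (fun _ : Fin 4 => V) ℝ :=
  MultilinearMap.mk' (fun v => cubicTerm T ξ e v w)
    (fun e i x y => by fin_cases i <;> simp [cubicTerm, Function.update] <;> ring)
    (fun e i c x => by fin_cases i <;> simp [cubicTerm, Function.update] <;> ring)

/-- `cubicTerm` as a multilinear map in the second group of vectors. -/
def cubicTermSnd (T : Form22 V) (ξ : V →ₗ[ℝ] ℝ) (e : Fin 4 → V →ₗ[ℝ] ℝ) (v : Fin 4 → V) :
    MultilinearMap ℝ (fun _ : Fin 4 => V) ℝ :=
  MultilinearMap.mk' (fun w => cubicTerm T ξ e v w)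
    (fun e i x y => by fin_cases i <;> simp [cubicTerm, Function.update] <;> ring)
    (fun e i c x => by fin_cases i <;> simp [cubicTerm, Function.update] <;> ring)

/-- The sign of a permutation as a real number. -/
abbrev sgn (σ : Equiv.Perm (Fin 4)) : ℝ := ((Equiv.Perm.sign σ : ℤ) : ℝ)

/-- The Tamm–Rubilar quartic at `ξ` (up to the factor `1/48`), with respect to a system of
covectors and two systems of vectors. -/
def cubicSum (T : Form22 V) (ξ : V →ₗ[ℝ] ℝ) (e : Fin 4 → V →ₗ[ℝ] ℝ) (v w : Fin 4 → V) : ℝ :=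
  ∑ σ : Equiv.Perm (Fin 4), sgn σ * ∑ τ : Equiv.Perm (Fin 4), sgn τ *
    ∑ ρ : Equiv.Perm (Fin 4), sgn ρ *
      cubicTerm T ξ (fun i => e (σ i)) (fun i => v (τ i)) (fun i => w (ρ i))

theorem cubicSum_basis (T : Form22 V) (ξ : V →ₗ[ℝ] ℝ) (e e' : Basis (Fin 4) ℝ (V →ₗ[ℝ] ℝ))
    (f f' : Basis (Fin 4) ℝ V) :
    cubicSum T ξ e f f = e'.det e * f'.det f ^ 2 * cubicSum T ξ e' f' f' := by
  have h₁ : ∀ (e : Fin 4 → V →ₗ[ℝ] ℝ) (v : Fin 4 → V),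
      ∑ ρ : Equiv.Perm (Fin 4), sgn ρ * cubicTerm T ξ e v (fun i => f (ρ i))
      = f'.det f * ∑ ρ : Equiv.Perm (Fin 4), sgn ρ * cubicTerm T ξ e v (fun i => f' (ρ i)) :=
    fun e v => sum_sign_mul_basis (cubicTermSnd T ξ e v) f f'
  have h₂ : ∀ (e : Fin 4 → V →ₗ[ℝ] ℝ) (w : Fin 4 → V),
      ∑ ρ : Equiv.Perm (Fin 4), sgn ρ * cubicTerm T ξ e (fun i => f (ρ i)) w
      = f'.det f * ∑ ρ : Equiv.Perm (Fin 4), sgn ρ * cubicTerm T ξ e (fun i => f' (ρ i)) w :=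
    fun e w => sum_sign_mul_basis (cubicTermFst T ξ e w) f f'
  have h₃ : ∀ (v w : Fin 4 → V),
      ∑ ρ : Equiv.Perm (Fin 4), sgn ρ * cubicTerm T ξ (fun i => e (ρ i)) v w
      = e'.det e * ∑ ρ : Equiv.Perm (Fin 4), sgn ρ * cubicTerm T ξ (fun i => e' (ρ i)) v w :=
    fun v w => sum_sign_mul_basis (cubicTermCovectors T ξ v w) e e'
  -- the three antisymmetrizations may be carried out in any order
  have c₁ : ∀ (x : Fin 4 → V →ₗ[ℝ] ℝ) (v w : Fin 4 → V), cubicSum T ξ x v w =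
      ∑ σ : Equiv.Perm (Fin 4), ∑ ρ : Equiv.Perm (Fin 4), sgn σ * sgn ρ *
        ∑ τ : Equiv.Perm (Fin 4), sgn τ *
          cubicTerm T ξ (fun i => x (σ i)) (fun i => v (τ i)) (fun i => w (ρ i)) := by
    intro x v w
    unfold cubicSum
    refine Finset.sum_congr rfl fun σ _ => ?_
    simp only [Finset.mul_sum]
    rw [Finset.sum_comm]
    refine Finset.sum_congr rfl fun _ _ => Finset.sum_congr rfl fun _ _ => by ring
  have c₂ : ∀ (x : Fin 4 → V →ₗ[ℝ] ℝ) (v w : Fin 4 → V), cubicSum T ξ x v w =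
      ∑ τ : Equiv.Perm (Fin 4), ∑ ρ : Equiv.Perm (Fin 4), sgn τ * sgn ρ *
        ∑ σ : Equiv.Perm (Fin 4), sgn σ *
          cubicTerm T ξ (fun i => x (σ i)) (fun i => v (τ i)) (fun i => w (ρ i)) := by
    intro x v w
    unfold cubicSum
    simp only [Finset.mul_sum]
    rw [Finset.sum_comm]
    refine Finset.sum_congr rfl fun τ _ => ?_
    rw [Finset.sum_comm]
    refine Finset.sum_congr rfl fun _ _ => Finset.sum_congr rfl fun _ _ => by ring
  have s₁ : cubicSum T ξ e f f = f'.det f * cubicSum T ξ e f f' := by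
    unfold cubicSum
    simp only [h₁, Finset.mul_sum]
    refine Finset.sum_congr rfl fun _ _ => Finset.sum_congr rfl fun _ _ =>
      Finset.sum_congr rfl fun _ _ => by ring
  have s₂ : cubicSum T ξ e f f' = f'.det f * cubicSum T ξ e f' f' := by
    rw [c₁, c₁]
    simp only [h₂, Finset.mul_sum]
    refine Finset.sum_congr rfl fun _ _ => Finset.sum_congr rfl fun _ _ =>
      Finset.sum_congr rfl fun _ _ => by ring
  have s₃ : cubicSum T ξ e f' f' = e'.det e * cubicSum T ξ e' f' f' := by
    rw [c₂, c₂]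
    simp only [h₃, Finset.mul_sum]
    refine Finset.sum_congr rfl fun _ _ => Finset.sum_congr rfl fun _ _ =>
      Finset.sum_congr rfl fun _ _ => by ring
  rw [s₁, s₂, s₃]
  ring

/-- The Tamm–Rubilar form of a (2,2)-form in a basis, polarized. -/
def polarForm (T : Form22 V) (f : Basis (Fin 4) ℝ V) (α β γ δ : V →ₗ[ℝ] ℝ) : ℝ :=
  (1 / 48) * ∑ a : Fin 4 → Fin 4, ∑ b : Fin 6 → Fin 4,
    T (f.coord (a 0)) (f.coord (a 1)) (f (b 0)) (f (b 1)) *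
    T (f.coord (a 2)) α (f (b 2)) (f (b 3)) *
    T (f.coord (a 3)) β (f (b 4)) (f (b 5)) *
    (∑ k, leviCivita (b 0) (b 1) (b 4) k * γ (f k)) *
    (∑ l, leviCivita (b 2) (b 3) (b 5) l * δ (f l)) *
    leviCivita (a 0) (a 1) (a 2) (a 3)

/-- With all covectors equal to ξ, the indices k and l join the six b's, and the eight indices split
according to the two upper Levi-Civita symbols that they enter. -/
theorem polarForm_self (T : Form22 V) (f : Basis (Fin 4) ℝ V) (ξ : V →ₗ[ℝ] ℝ) :
    polarForm T f ξ ξ ξ ξ = (1 / 48) * cubicSum T ξ f.coord f f := by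
  -- The regrouping (b₀, b₁, b₄, k), (b₂, b₃, b₅, l).
  let E : (Fin 6 → Fin 4) × Fin 4 × Fin 4 ≃ (Fin 4 → Fin 4) × (Fin 4 → Fin 4) :=
    { toFun := fun x => (![x.1 0, x.1 1, x.1 4, x.2.1], ![x.1 2, x.1 3, x.1 5, x.2.2])
      invFun := fun y => (![y.1 0, y.1 1, y.2 0, y.2 1, y.1 2, y.2 2], y.1 3, y.2 3)
      left_inv := fun x => by
        refine Prod.ext ?_ rfl
        ext i; fin_cases i <;> rfl
      right_inv := fun y => by
        refine Prod.ext ?_ ?_ <;> (ext i; fin_cases i <;> rfl) }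
  have h : ∀ a : Fin 4 → Fin 4, ∑ b : Fin 6 → Fin 4,
      T (f.coord (a 0)) (f.coord (a 1)) (f (b 0)) (f (b 1)) *
      T (f.coord (a 2)) ξ (f (b 2)) (f (b 3)) *
      T (f.coord (a 3)) ξ (f (b 4)) (f (b 5)) *
      (∑ k, leviCivita (b 0) (b 1) (b 4) k * ξ (f k)) *
      (∑ l, leviCivita (b 2) (b 3) (b 5) l * ξ (f l)) *
      leviCivita (a 0) (a 1) (a 2) (a 3)
      = leviCivita (a 0) (a 1) (a 2) (a 3) *
        ∑ c : Fin 4 → Fin 4, leviCivita (c 0) (c 1) (c 2) (c 3) *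
        ∑ d : Fin 4 → Fin 4, leviCivita (d 0) (d 1) (d 2) (d 3) *
          cubicTerm T ξ (fun i => f.coord (a i)) (fun i => f (c i)) (fun i => f (d i)) := by
    intro a
    simp only [Finset.mul_sum, Finset.sum_mul]
    rw [← Fintype.sum_prod_type' (f := fun c d : Fin 4 → Fin 4 =>
      leviCivita (a 0) (a 1) (a 2) (a 3) * (leviCivita (c 0) (c 1) (c 2) (c 3) *
        (leviCivita (d 0) (d 1) (d 2) (d 3) *
          cubicTerm T ξ (fun i => f.coord (a i)) (fun i => f (c i)) (fun i => f (d i))))),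
      ← E.sum_comp, Fintype.sum_prod_type]
    refine Finset.sum_congr rfl fun b _ => ?_
    rw [Fintype.sum_prod_type, Finset.sum_comm]
    refine Finset.sum_congr rfl fun k _ => Finset.sum_congr rfl fun l _ => ?_
    simp only [E, cubicTerm, Equiv.coe_fn_mk, Matrix.cons_val]
    ring
  unfold polarForm cubicSum
  simp only [h]
  rw [sum_leviCivita_mul]
  congr 1
  refine Finset.sum_congr rfl fun σ _ => ?_
  rw [sum_leviCivita_mul]
  congr 1
  refine Finset.sum_congr rfl fun τ _ => ?_
  rw [sum_leviCivita_mul]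

/-- If two (2,2)-forms have proportional quartics, then their symmetrized Tamm–Rubilar tensors
are proportional. -/
theorem sum_polarForm_eq (T T' : Form22 V) (f : Basis (Fin 4) ℝ V) (c : ℝ)
    (h : ∀ ξ, cubicSum T ξ f.coord f f = c * cubicSum T' ξ f.coord f f)
    (u : Fin 4 → V →ₗ[ℝ] ℝ) :
    ∑ σ : Equiv.Perm (Fin 4), polarForm T f (u (σ 0)) (u (σ 1)) (u (σ 2)) (u (σ 3))
      = c * ∑ σ : Equiv.Perm (Fin 4), polarForm T' f (u (σ 0)) (u (σ 1)) (u (σ 2)) (u (σ 3)) := by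
  have a₁ : ∀ (T : Form22 V) x x' y z w,
      polarForm T f (x + x') y z w = polarForm T f x y z w + polarForm T f x' y z w := by
    intro T x x' y z w
    simp only [polarForm, ← mul_add, ← Finset.sum_add_distrib, map_add, LinearMap.add_apply]
    simp only [mul_add, add_mul, Finset.sum_add_distrib]
  have a₂ : ∀ (T : Form22 V) x y y' z w,
      polarForm T f x (y + y') z w = polarForm T f x y z w + polarForm T f x y' z w := by
    intro T x x' y z w
    simp only [polarForm, ← mul_add, ← Finset.sum_add_distrib, map_add, LinearMap.add_apply]
    simp only [mul_add, add_mul, Finset.sum_add_distrib]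
  have a₃ : ∀ (T : Form22 V) x y z z' w,
      polarForm T f x y (z + z') w = polarForm T f x y z w + polarForm T f x y z' w := by
    intro T x x' y z w
    simp only [polarForm, LinearMap.add_apply, mul_add, add_mul, Finset.sum_add_distrib]
  have a₄ : ∀ (T : Form22 V) x y z w w',
      polarForm T f x y z (w + w') = polarForm T f x y z w + polarForm T f x y z w' := by
    intro T x x' y z w
    simp only [polarForm, LinearMap.add_apply, mul_add, add_mul, Finset.sum_add_distrib]
  -- The difference of the two forms is 4-additive and vanishes on the diagonal.
  have key := symmetrization_eq_zero
    (fun x y z w => polarForm T f x y z w - c * polarForm T' f x y z w)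
    (fun x x' y z w => by simp only [a₁]; ring) (fun x y y' z w => by simp only [a₂]; ring)
    (fun x y z z' w => by simp only [a₃]; ring) (fun x y z w w' => by simp only [a₄]; ring)
    (fun x => by simp only [polarForm_self, h]; ring) u
  rw [Finset.sum_sub_distrib, ← Finset.mul_sum, sub_eq_zero] at key
  exact key

end Forms

/-! ### The wedge pairing and the block matrix of an operator on 2-forms -/

section Blocks

variable {V : Type*} [AddCommGroup V] [Module ℝ V]

theorem alternatingMap_sum_apply {ι κ : Type*} (s : Finset κ) (u : κ → V [⋀^ι]→ₗ[ℝ] ℝ)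
    (v : ι → V) : (∑ k ∈ s, u k) v = ∑ k ∈ s, u k v := by
  classical
  induction s using Finset.induction_on with
  | empty => simp
  | insert a s ha ih => rw [Finset.sum_insert ha, Finset.sum_insert ha,
      AlternatingMap.add_apply, ih]

/-- The wedge product of 2-forms, evaluated on four vectors. -/
theorem wedgeTwo_apply (u v : V [⋀^Fin 2]→ₗ[ℝ] ℝ) (x : Fin 4 → V) :
    wedgeTwo u v (fun i => x (finSumFinEquiv i)) =
      u ![x 0, x 1] * v ![x 2, x 3] - u ![x 0, x 2] * v ![x 1, x 3]
      + u ![x 0, x 3] * v ![x 1, x 2] + u ![x 1, x 2] * v ![x 0, x 3]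
      - u ![x 1, x 3] * v ![x 0, x 2] + u ![x 2, x 3] * v ![x 0, x 1] := by
  -- Antisymmetrizing u ⊗ v over all 24 permutations counts each shuffle 2!·2! times; the factor 4
  -- is divided out at the end.
  have h := congrArg (fun F => LinearMap.mul' ℝ ℝ (F (fun i => x (finSumFinEquiv i))))
    (MultilinearMap.domCoprod_alternization_eq u v)
  simp only [AlternatingMap.smul_apply, MultilinearMap.alternatization_apply,
    MultilinearMap.domDomCongr_apply, MultilinearMap.domCoprod_apply, map_sum] at h
  simp only [Units.smul_def, map_zsmul, map_nsmul, LinearMap.mul'_apply] at h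
  simp only [zsmul_eq_mul, Fintype.card_fin, nsmul_eq_mul] at h
  rw [← (finSumFinEquiv (m := 2) (n := 2)).permCongr.symm.sum_comp] at h
  have e : ∀ σ : Equiv.Perm (Fin 4),
      (u fun i => x (finSumFinEquiv
        (((finSumFinEquiv (m := 2) (n := 2)).permCongr.symm σ) (Sum.inl i)))) =
        u ![x (σ 0), x (σ 1)] := by
    intro σ
    congr 1
    ext i
    fin_cases i <;> simp [Equiv.permCongr] <;> rfl
  have e' : ∀ σ : Equiv.Perm (Fin 4),
      (v fun i => x (finSumFinEquiv
        (((finSumFinEquiv (m := 2) (n := 2)).permCongr.symm σ) (Sum.inr i)))) =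
        v ![x (σ 2), x (σ 3)] := by
    intro σ
    congr 1
    ext i
    fin_cases i <;> simp [Equiv.permCongr] <;> rfl
  have s : ∀ σ : Equiv.Perm (Fin 4),
      Equiv.Perm.sign ((finSumFinEquiv (m := 2) (n := 2)).permCongr.symm σ)
        = Equiv.Perm.sign σ :=
    fun σ => Equiv.Perm.sign_permCongr (finSumFinEquiv (m := 2) (n := 2)).symm σ
  simp only [s] at h
  replace h := (Finset.sum_congr rfl fun (σ : Equiv.Perm (Fin 4)) _ =>
    congrArg (sgn σ * ·) (congrArg₂ (· * ·) (e σ) (e' σ))).symm.trans h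
  rw [sum_sign_mul_perm_four fun i j k l => u ![x i, x j] * v ![x k, x l]] at h
  rw [twoForm_swap u (x 1) (x 0), twoForm_swap u (x 2) (x 0), twoForm_swap u (x 3) (x 0),
    twoForm_swap u (x 2) (x 1), twoForm_swap u (x 3) (x 1), twoForm_swap u (x 3) (x 2),
    twoForm_swap v (x 1) (x 0), twoForm_swap v (x 2) (x 0), twoForm_swap v (x 3) (x 0),
    twoForm_swap v (x 2) (x 1), twoForm_swap v (x 3) (x 1), twoForm_swap v (x 3) (x 2)] at h
  have w : wedgeTwo u v (fun i => x (finSumFinEquiv i)) =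
      LinearMap.mul' ℝ ℝ (u.domCoprod v (fun i => x (finSumFinEquiv i))) := rfl
  rw [← w] at h
  norm_num [Nat.factorial] at h
  linarith

/-- First members of the pairs `01, 02, 03; 23, 31, 12`. -/
def pairFst : Fin 3 ⊕ Fin 3 → Fin 4 := Sum.elim (fun _ => 0) (fun p => (p + 1).succ)

/-- Second members of the pairs `01, 02, 03; 23, 31, 12`. -/
def pairSnd : Fin 3 ⊕ Fin 3 → Fin 4 := Sum.elim Fin.succ (fun p => (p + 2).succ)

/-- The basis `e⁰¹, e⁰², e⁰³; e²³, e³¹, e¹²` of the 2-forms. -/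
def twoFormBasis (f : Basis (Fin 4) ℝ V) : Basis (Fin 3 ⊕ Fin 3) ℝ (V [⋀^Fin 2]→ₗ[ℝ] ℝ) :=
  Basis.ofEquivFun
    { toFun := fun u k => u ![f (pairFst k), f (pairSnd k)]
      map_add' := fun _ _ => rfl
      map_smul' := fun _ _ => rfl
      invFun := fun c => ∑ k, c k • wedgeOne (f.coord (pairFst k)) (f.coord (pairSnd k))
      left_inv := fun u => by
        refine Basis.ext_alternating f fun i _ => ?_
        rw [← vec_two_eta fun j => f (i j)]
        generalize i 0 = m, i 1 = n
        simp only [alternatingMap_sum_apply, AlternatingMap.smul_apply, wedgeOne_apply]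
        simp only [Basis.coord_apply, Basis.repr_self, Finsupp.single_apply, Fintype.sum_sum_type,
          Fin.sum_univ_three, pairFst, pairSnd, Sum.elim_inl, Sum.elim_inr, smul_eq_mul]
        fin_cases m <;> fin_cases n <;>
          simp +decide [twoForm_self, twoForm_swap u (f 1) (f 0), twoForm_swap u (f 2) (f 0),
              twoForm_swap u (f 3) (f 0), twoForm_swap u (f 2) (f 1), twoForm_swap u (f 3) (f 1),
              twoForm_swap u (f 3) (f 2)]
      right_inv := fun c => by
        ext k
        simp only [alternatingMap_sum_apply, AlternatingMap.smul_apply, wedgeOne_apply]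
        simp only [Basis.coord_apply, Basis.repr_self, Finsupp.single_apply, Fintype.sum_sum_type,
          Fin.sum_univ_three, pairFst, pairSnd, Sum.elim_inl, Sum.elim_inr, smul_eq_mul]
        rcases k with k | k <;> fin_cases k <;> simp +decide }

theorem twoFormBasis_repr (f : Basis (Fin 4) ℝ V) (u : V [⋀^Fin 2]→ₗ[ℝ] ℝ)
    (k : Fin 3 ⊕ Fin 3) :
    (twoFormBasis f).repr u k = u ![f (pairFst k), f (pairSnd k)] := by
  simp [twoFormBasis]

theorem twoFormBasis_apply (f : Basis (Fin 4) ℝ V) (k : Fin 3 ⊕ Fin 3) :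
    twoFormBasis f k = wedgeOne (f.coord (pairFst k)) (f.coord (pairSnd k)) := by
  have h : ∑ x, (Pi.single k (1 : ℝ) : Fin 3 ⊕ Fin 3 → ℝ) x •
      wedgeOne (f.coord (pairFst x)) (f.coord (pairSnd x)) =
      wedgeOne (f.coord (pairFst k)) (f.coord (pairSnd k)) := by
    simp [Pi.single_apply, ite_smul]
  rw [← h, twoFormBasis, Basis.coe_ofEquivFun]
  rfl

/-- The matrix of an operator on 2-forms in the basis `e⁰¹, e⁰², e⁰³; e²³, e³¹, e¹²`. -/
def opMatrix (f : Basis (Fin 4) ℝ V) (A : End ℝ (V [⋀^Fin 2]→ₗ[ℝ] ℝ)) :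
    Matrix (Fin 3 ⊕ Fin 3) (Fin 3 ⊕ Fin 3) ℝ :=
  LinearMap.toMatrix (twoFormBasis f) (twoFormBasis f) A

/-- The block of an operator sending `e⁰ ∧ V*` to the 2-forms modulo `e⁰ ∧ V*`. -/
def offBlock (f : Basis (Fin 4) ℝ V) (A : End ℝ (V [⋀^Fin 2]→ₗ[ℝ] ℝ)) :
    Matrix (Fin 3) (Fin 3) ℝ :=
  (opMatrix f A).toBlocks₂₁

/-- The additions `p + 1`, `p + 2` wrap around in `Fin 3`, and `succ` then moves to the spatial
indices 1, 2, 3; this yields the cyclic pairs 23, 31, 12. -/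
theorem offBlock_apply (f : Basis (Fin 4) ℝ V) (A : End ℝ (V [⋀^Fin 2]→ₗ[ℝ] ℝ)) (p a : Fin 3) :
    offBlock f A p a =
      A (wedgeOne (f.coord 0) (f.coord a.succ)) ![f (p + 1).succ, f (p + 2).succ] := by
  simp only [offBlock, opMatrix, Matrix.toBlocks₂₁, Matrix.of_apply, LinearMap.toMatrix_apply,
    twoFormBasis_repr, twoFormBasis_apply]
  rfl

/-! ### The quartic as a 3×3 determinant -/

/-- Since δ is dual to index 0, only the spatial parts of the forms survive. Read as vectors (x₂₃,
x₃₁, x₁₂) and so on, they give 4 times the determinant of the three vectors. -/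
theorem sum_sum_sign_three_forms (x y z : Fin 4 → Fin 4 → ℝ)
    (hx : ∀ i j, x i j = -x j i) (hy : ∀ i j, y i j = -y j i) (hz : ∀ i j, z i j = -z j i)
    (δ : Fin 4 → ℝ) (h₀ : δ 0 = 1) (h₁ : δ 1 = 0) (h₂ : δ 2 = 0) (h₃ : δ 3 = 0) :
    ∑ τ : Equiv.Perm (Fin 4), sgn τ * ∑ ρ : Equiv.Perm (Fin 4), sgn ρ *
        (x (τ 0) (τ 1) * y (ρ 0) (ρ 1) * z (τ 2) (ρ 2) * δ (τ 3) * δ (ρ 3))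
      = 4 * (x 2 3 * y 3 1 * z 1 2 + x 3 1 * y 1 2 * z 2 3 + x 1 2 * y 2 3 * z 3 1
        - x 2 3 * y 1 2 * z 3 1 - x 3 1 * y 2 3 * z 1 2 - x 1 2 * y 3 1 * z 2 3) := by
  -- Only ρ with ρ 3 = 0 survive. The arrangement (1, 2, 3, 0) is a 4-cycle, hence the minus sign;
  -- antisymmetry of `y` doubles each term. The sum over τ gives another factor -2.
  have e : ∀ i j k l : Fin 4, ∑ ρ : Equiv.Perm (Fin 4), sgn ρ *
      (x i j * y (ρ 0) (ρ 1) * z k (ρ 2) * δ l * δ (ρ 3)) =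
      -2 * (x i j * δ l * (y 1 2 * z k 3 + y 2 3 * z k 1 + y 3 1 * z k 2)) := by
    intro i j k l
    rw [sum_sign_mul_perm_four fun p q r s => x i j * y p q * z k r * δ l * δ s, h₀, h₁, h₂, h₃,
      hy 2 1, hy 3 2, hy 1 3]
    ring
  simp only [e]
  have hz' : ∀ i, z i i = 0 := fun i => by linarith [hz i i]
  rw [sum_sign_mul_perm_four fun i j k l =>
    -2 * (x i j * δ l * (y 1 2 * z k 3 + y 2 3 * z k 1 + y 3 1 * z k 2)), h₀, h₁, h₂, h₃,
    hx 2 1, hx 3 2, hx 1 3, hz' 1, hz' 2, hz' 3, hz 2 1, hz 3 2, hz 1 3]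
  ring

/-- In a basis with `e⁰ = ξ`, the Tamm–Rubilar quartic at `ξ` is a `3 × 3` determinant. -/
theorem cubicSum_coord_zero (f : Basis (Fin 4) ℝ V) (A : End ℝ (V [⋀^Fin 2]→ₗ[ℝ] ℝ)) :
    cubicSum (operatorForm A) (f.coord 0) f.coord f f = 48 * (offBlock f A).det := by
  set X : Fin 4 → Fin 4 → Fin 4 → Fin 4 → ℝ :=
    fun i j k l => A (wedgeOne (f.coord i) (f.coord j)) ![f k, f l] with hX
  have h₁ : ∀ i j k l, X i j k l = -X i j l k := fun i j k l => twoForm_swap _ _ _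
  have h₂ : ∀ i j k l, X i j k l = -X j i k l := fun i j k l => by
    simp only [hX]
    rw [wedgeOne_swap, map_neg, AlternatingMap.neg_apply]
  have h₃ : ∀ i k l, X i i k l = 0 := fun i k l => by
    simp [hX, wedgeOne_self]
  have e : ∀ i j k l : Fin 4, ∑ τ : Equiv.Perm (Fin 4), sgn τ *
      ∑ ρ : Equiv.Perm (Fin 4), sgn ρ *
        (X i j (τ 0) (τ 1) * X k 0 (ρ 0) (ρ 1) * X l 0 (τ 2) (ρ 2) * f.coord 0 (f (τ 3)) *
          f.coord 0 (f (ρ 3))) = _ := fun i j k l =>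
    sum_sum_sign_three_forms (X i j) (X k 0) (X l 0) (h₁ i j) (h₁ k 0) (h₁ l 0)
      (fun m => f.coord 0 (f m)) (by simp) (by simp) (by simp) (by simp)
  have s : cubicSum (operatorForm A) (f.coord 0) f.coord f f =
      ∑ σ : Equiv.Perm (Fin 4), sgn σ * ∑ τ : Equiv.Perm (Fin 4), sgn τ *
      ∑ ρ : Equiv.Perm (Fin 4), sgn ρ *
        (X (σ 0) (σ 1) (τ 0) (τ 1) * X (σ 2) 0 (ρ 0) (ρ 1) * X (σ 3) 0 (τ 2) (ρ 2) *
          f.coord 0 (f (τ 3)) * f.coord 0 (f (ρ 3))) := rfl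
  have d : (offBlock f A).det =
      X 0 1 2 3 * X 0 2 3 1 * X 0 3 1 2 - X 0 1 2 3 * X 0 3 3 1 * X 0 2 1 2
      - X 0 2 2 3 * X 0 1 3 1 * X 0 3 1 2 + X 0 2 2 3 * X 0 3 3 1 * X 0 1 1 2
      + X 0 3 2 3 * X 0 1 3 1 * X 0 2 1 2 - X 0 3 2 3 * X 0 2 3 1 * X 0 1 1 2 := by
    rw [Matrix.det_fin_three]
    simp only [offBlock_apply]
    rfl
  rw [s, d]
  simp only [e]
  -- The index 0 must be one of σ 0, σ 1, since X 0 0 = 0. The 12 remaining permutations each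
  -- contribute 4 times the determinant, hence 48.
  rw [sum_sign_mul_perm_four fun i j k l =>
    4 * (X i j 2 3 * X k 0 3 1 * X l 0 1 2 + X i j 3 1 * X k 0 1 2 * X l 0 2 3
      + X i j 1 2 * X k 0 2 3 * X l 0 3 1 - X i j 2 3 * X k 0 1 2 * X l 0 3 1
      - X i j 3 1 * X k 0 2 3 * X l 0 1 2 - X i j 1 2 * X k 0 3 1 * X l 0 2 3)]
  simp only [h₃, h₂ 1 0, h₂ 2 0, h₂ 3 0]
  ring

/-- A vector y with ξ y = 1, followed by a basis of ker ξ, has ξ as its zeroth coordinate. -/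
theorem exists_basis_coord_zero (f : Basis (Fin 4) ℝ V) (ξ : V →ₗ[ℝ] ℝ) (hξ : ξ ≠ 0) :
    ∃ f' : Basis (Fin 4) ℝ V, f'.coord 0 = ξ := by
  have : Module.Finite ℝ V := Module.Finite.of_basis f
  obtain ⟨y, hy⟩ : ∃ y, ξ y = 1 := by
    obtain ⟨x, hx⟩ : ∃ x, ξ x ≠ 0 := by
      by_contra! h
      exact hξ (LinearMap.ext h)
    exact ⟨(ξ x)⁻¹ • x, by simp [hx]⟩
  have hr : finrank ℝ (LinearMap.ker ξ) = 3 := by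
    have h := LinearMap.finrank_range_add_finrank_ker ξ
    rw [finrank_eq_card_basis f, Fintype.card_fin, LinearMap.range_eq_top.2, finrank_top,
      finrank_self] at h
    · omega
    · exact fun c => ⟨c • y, by simp [hy]⟩
  let b := finBasisOfFinrankEq ℝ (LinearMap.ker ξ) hr
  let f' : Basis (Fin 4) ℝ V := Basis.mkFinCons y b
    (fun c x hx h => by
      have := congrArg ξ h
      simpa [hy, LinearMap.mem_ker.1 hx] using this)
    (fun z => ⟨-ξ z, by simp [hy]⟩)
  have hf' : (f' : Fin 4 → V) = Fin.cons y (fun i => (b i : V)) := Basis.coe_mkFinCons _ _ _ _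
  refine ⟨f', f'.ext fun i => ?_⟩
  rw [Basis.coord_apply, Basis.repr_self, Finsupp.single_apply, hf']
  induction i using Fin.cases with
  | zero => simp [hy]
  | succ i => simp

/-- At each covector the Tamm–Rubilar quartic is, up to a factor independent of the operator, the
determinant of an off-diagonal block. -/
theorem exists_cubicSum_eq (f : Basis (Fin 4) ℝ V) (ξ : V →ₗ[ℝ] ℝ) :
    ∃ (f' : Basis (Fin 4) ℝ V) (c : ℝ), ∀ A : End ℝ (V [⋀^Fin 2]→ₗ[ℝ] ℝ),
      cubicSum (operatorForm A) ξ f.coord f f = c * (offBlock f' A).det := by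
  rcases eq_or_ne ξ 0 with rfl | hξ
  -- No adapted basis exists for ξ = 0, but the quartic vanishes there.
  · exact ⟨f, 0, fun A => by simp [cubicSum, cubicTerm]⟩
  · obtain ⟨f', rfl⟩ := exists_basis_coord_zero f ξ hξ
    refine ⟨f', f'.dualBasis.det f.dualBasis * f'.det f ^ 2 * 48, fun A => ?_⟩
    have h := cubicSum_basis (operatorForm A) (f'.coord 0) f.dualBasis f'.dualBasis f f'
    rw [Basis.coe_dualBasis, Basis.coe_dualBasis, cubicSum_coord_zero] at h
    rw [h, Basis.coe_dualBasis]
    ring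

/-! ### Block determinants of shifted, scaled, skew and inverse operators -/

theorem offBlock_add_smul_one (f : Basis (Fin 4) ℝ V) (A : End ℝ (V [⋀^Fin 2]→ₗ[ℝ] ℝ)) (c : ℝ) :
    offBlock f (A + c • 1) = offBlock f A := by
  ext p a
  simp [offBlock, opMatrix, Matrix.toBlocks₂₁, LinearMap.toMatrix_one]

theorem offBlock_smul (f : Basis (Fin 4) ℝ V) (A : End ℝ (V [⋀^Fin 2]→ₗ[ℝ] ℝ)) (c : ℝ) :
    offBlock f (c • A) = c • offBlock f A := by
  ext p a
  simp [offBlock, opMatrix, Matrix.toBlocks₂₁]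

/-- The block is the Gram matrix of (u, v) ↦ u ∧ A v on e⁰ ∧ V*. Skewness of `A` makes it
antisymmetric, because 2-forms commute under the wedge; its size 3 is odd. -/
theorem det_offBlock_of_skew (f : Basis (Fin 4) ℝ V) (A : End ℝ (V [⋀^Fin 2]→ₗ[ℝ] ℝ))
    (hA : ∀ u v, wedgeTwo u (A v) = -wedgeTwo (A u) v) : (offBlock f A).det = 0 := by
  have h : ∀ p a, wedgeTwo (wedgeOne (f.coord 0) (f.coord (Fin.succ p)))
      (A (wedgeOne (f.coord 0) (f.coord (Fin.succ a)))) (fun i => f (finSumFinEquiv i))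
        = offBlock f A p a := by
    intro p a
    rw [wedgeTwo_apply, offBlock_apply]
    simp only [wedgeOne_apply, Basis.coord_apply, Basis.repr_self, Finsupp.single_apply]
    fin_cases p <;> simp +decide
    exact (twoForm_swap _ _ _).symm
  have h' : ∀ p a, wedgeTwo (A (wedgeOne (f.coord 0) (f.coord (Fin.succ p))))
      (wedgeOne (f.coord 0) (f.coord (Fin.succ a))) (fun i => f (finSumFinEquiv i))
        = offBlock f A a p := by
    intro p a
    rw [wedgeTwo_apply, offBlock_apply]
    simp only [wedgeOne_apply, Basis.coord_apply, Basis.repr_self, Finsupp.single_apply]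
    fin_cases a <;> simp +decide
    exact (twoForm_swap _ _ _).symm
  have t : (offBlock f A).transpose = -offBlock f A := by
    ext p a
    rw [Matrix.transpose_apply, Matrix.neg_apply, ← h' p a, ← h p a, hA, AlternatingMap.neg_apply,
      neg_neg]
  have d := congrArg Matrix.det t
  rw [Matrix.det_transpose, Matrix.det_neg, Fintype.card_fin] at d
  linarith

/-- Jacobi's identity for complementary minors: det M · det R₂₁ = det(-M₂₁), with sign (-1)³. -/
theorem det_offBlock_inverse (f : Basis (Fin 4) ℝ V) (A : End ℝ (V [⋀^Fin 2]→ₗ[ℝ] ℝ))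
    (hA : IsUnit A) :
    (offBlock f (Ring.inverse A)).det = -(LinearMap.det A)⁻¹ * (offBlock f A).det := by
  set M := opMatrix f A
  set R := opMatrix f (Ring.inverse A)
  have hMR : M * R = 1 := by
    simp only [M, R, opMatrix]
    rw [← LinearMap.toMatrix_mul, Ring.mul_inverse_cancel _ hA, LinearMap.toMatrix_one]
  have hd : LinearMap.det A = M.det := (LinearMap.det_toMatrix (twoFormBasis f) A).symm
  have hM : M.det ≠ 0 := by
    intro h
    have := congrArg Matrix.det hMR
    simp [h] at this
  have h : Matrix.fromBlocks (M.toBlocks₁₁ * R.toBlocks₁₁ + M.toBlocks₁₂ * R.toBlocks₂₁)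
      (M.toBlocks₁₁ * R.toBlocks₁₂ + M.toBlocks₁₂ * R.toBlocks₂₂)
      (M.toBlocks₂₁ * R.toBlocks₁₁ + M.toBlocks₂₂ * R.toBlocks₂₁)
      (M.toBlocks₂₁ * R.toBlocks₁₂ + M.toBlocks₂₂ * R.toBlocks₂₂)
      = Matrix.fromBlocks 1 0 0 1 := by
    rw [← Matrix.fromBlocks_multiply, Matrix.fromBlocks_toBlocks, Matrix.fromBlocks_toBlocks, hMR,
      Matrix.fromBlocks_one]
  obtain ⟨h₁₁, -, h₂₁, -⟩ := Matrix.fromBlocks_inj.1 h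
  -- The first block column of `R` is sent by `M` to (1, 0), so the first product is [[M₁₁, 1],
  -- [M₂₁, 0]]. The column operation by 1 - M₁₁ puts the identity in the upper left corner, ready
  -- for the Schur complement formula.
  have key : M * Matrix.fromBlocks 1 R.toBlocks₁₁ 0 R.toBlocks₂₁ *
      Matrix.fromBlocks 1 0 (1 - M.toBlocks₁₁) 1 = Matrix.fromBlocks 1 1 M.toBlocks₂₁ 0 := by
    conv_lhs => rw [← Matrix.fromBlocks_toBlocks M]
    simp [Matrix.fromBlocks_multiply, h₁₁, h₂₁]
  have hdet := congrArg Matrix.det key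
  rw [Matrix.det_mul, Matrix.det_mul, Matrix.det_fromBlocks_zero₂₁, Matrix.det_fromBlocks_zero₁₂,
    Matrix.det_fromBlocks_one₁₁, mul_one, zero_sub, Matrix.det_neg, Fintype.card_fin] at hdet
  simp only [Matrix.det_one, one_mul, mul_one] at hdet
  change R.toBlocks₂₁.det = -(LinearMap.det A)⁻¹ * M.toBlocks₂₁.det
  rw [hd]
  field_simp
  linarith

end Blocks

/-! ### From linear algebra to tensor densities on the manifold -/

section Manifold

variable {N : Type*} [TopologicalSpace N] [ChartedSpace E4 N]

/-- The coordinate vectors form a basis of the tangent space, with dual basis the coordinate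
covectors. -/
theorem exists_frame_basis [IsManifold (𝓡 4) ∞ N] (φ : SmoothChart N) {p : N}
    (hp : p ∈ φ.1.source) :
    ∃ f : Basis (Fin 4) ℝ (TangentSpace (𝓡 4) p),
      (∀ i, f i = frame φ p i) ∧ ∀ i, f.coord i = coframe φ p i := by
  have hφ : φ.1.MDifferentiable (𝓡 4) 𝓘(ℝ, E4) :=
    ⟨(contMDiffOn_of_mem_maximalAtlas φ.2).mdifferentiableOn (by simp),
      (contMDiffOn_symm_of_mem_maximalAtlas φ.2).mdifferentiableOn (by simp)⟩
  let L : TangentSpace (𝓡 4) p ≃L[ℝ] E4 := hφ.mfderiv hp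
  let f : Basis (Fin 4) ℝ (TangentSpace (𝓡 4) p) :=
    (EuclideanSpace.basisFun (Fin 4) ℝ).toBasis.map L.symm.toLinearEquiv
  have hf : ∀ i, f i = L.symm (EuclideanSpace.single i 1) := fun i => by simp [f]
  refine ⟨f, fun i => ?_, fun i => f.ext fun j => ?_⟩
  · rw [hf]
    -- On the chart domain the derivative is the equivalence `L`, so the `inverse` in `frame` is a
    -- true inverse and not the default 0.
    exact (congrArg (fun T : E4 →L[ℝ] TangentSpace (𝓡 4) p => T (EuclideanSpace.single i 1))
      (ContinuousLinearMap.inverse_equiv L)).symm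
  · have h : coframe φ p i (f j) = (L (f j)) i := rfl
    rw [h, Basis.coord_apply, Basis.repr_self, hf, L.apply_symm_apply]
    simp [Finsupp.single_apply, eq_comm]

/-- Evaluating the dual covectors on the basis vectors collapses the sums over k and l to the chosen
free indices. -/
theorem G₀_eq_polarForm (κ : TensorField22 N) (φ : SmoothChart N) (p : φ.1.source)
    (f : Basis (Fin 4) ℝ (TangentSpace (𝓡 4) p.1)) (hf : ∀ i, f i = frame φ p i)
    (hf' : ∀ i, f.coord i = coframe φ p i) (i j k l : Fin 4) :
    G₀ κ φ p i j k l = polarForm (operatorForm (κ p)) f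
      (f.coord i) (f.coord j) (f.coord k) (f.coord l) := by
  have h : ∀ (g : Fin 4 → ℝ) (m : Fin 4), ∑ n, g n * f.coord m (f n) = g m := fun g m => by
    simp [Finsupp.single_apply]
  simp only [hf, hf'] at h
  simp only [polarForm, G₀, comp, operatorForm_apply, hf, hf', h]

/-- If the off-diagonal block determinants of two tensors at a point are proportional, then so
are their Tamm–Rubilar tensor densities at that point. -/
theorem G_eq_mul_of_det_offBlock [IsManifold (𝓡 4) ∞ N] (κ κ' : TensorField22 N) (p : N) (c : ℝ)
    (h : ∀ f : Basis (Fin 4) ℝ (TangentSpace (𝓡 4) p),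
      (offBlock f (κ p)).det = c * (offBlock f (κ' p)).det)
    (φ : SmoothChart N) (hp : p ∈ φ.1.source) (i j k l : Fin 4) :
    G κ φ ⟨p, hp⟩ i j k l = c * G κ' φ ⟨p, hp⟩ i j k l := by
  obtain ⟨f, hf, hf'⟩ := exists_frame_basis φ hp
  have key := sum_polarForm_eq (operatorForm (κ p)) (operatorForm (κ' p)) f c (fun ξ => by
    obtain ⟨f', d, hd⟩ := exists_cubicSum_eq f ξ
    rw [hd, hd, h]
    ring) (fun m => f.coord (![i, j, k, l] m))
  simp only [G, G₀_eq_polarForm _ φ ⟨p, hp⟩ f hf hf']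
  rw [key]
  ring

theorem G_inv [IsManifold (𝓡 4) ∞ N] (κ : TensorField22 N) (hκ : Invertible κ)
    (φ : SmoothChart N) (p : φ.1.source) (i j k l : Fin 4) :
    G (inv κ) φ p i j k l = -(det κ p)⁻¹ * G κ φ p i j k l :=
  G_eq_mul_of_det_offBlock (inv κ) κ p (-(det κ p)⁻¹)
    (fun f => det_offBlock_inverse f (κ p) (hκ p)) φ p.2 i j k l

theorem G_smul [IsManifold (𝓡 4) ∞ N] (f : N → ℝ) (κ : TensorField22 N)
    (φ : SmoothChart N) (p : φ.1.source) (i j k l : Fin 4) :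
    G (fun q => f q • κ q) φ p i j k l = f p ^ 3 * G κ φ p i j k l :=
  G_eq_mul_of_det_offBlock (fun q => f q • κ q) κ p (f p ^ 3) (fun b => by
    rw [offBlock_smul, Matrix.det_smul, Fintype.card_fin]) φ p.2 i j k l

theorem det_ne_zero (κ : TensorField22 N) (hκ : Invertible κ) (p : N) : det κ p ≠ 0 :=
  ((hκ p).map (LinearMap.det : End ℝ (TwoCovector p) →* ℝ)).ne_zero

end Manifold

end TammRubilar

end

theorem theorem5p1 {N : Type*} [TopologicalSpace N] [T2Space N] [SecondCountableTopology N]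
    [ChartedSpace TammRubilar.E4 N] [IsManifold (𝓡 4) ∞ N]
    (κ : TammRubilar.TensorField22 N) (hκ : TammRubilar.IsSmooth κ) :
    (∀ f : N → ℝ, ContMDiff (𝓡 4) 𝓘(ℝ, ℝ) ∞ f →
      TammRubilar.G (fun p => f p • κ p)
        = TammRubilar.fsmul (fun p => f p ^ 3) (TammRubilar.G κ)) ∧
    (∀ σ : TammRubilar.TensorField22 N, TammRubilar.IsSkewonPart σ κ →
      TammRubilar.G σ = 0) ∧
    (∀ f : N → ℝ, ContMDiff (𝓡 4) 𝓘(ℝ, ℝ) ∞ f →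
      TammRubilar.G κ = TammRubilar.G (fun p => κ p + f p • 1)) ∧
    (TammRubilar.Invertible κ →
      TammRubilar.G (TammRubilar.inv κ)
        = TammRubilar.G (fun p => (-TammRubilar.invCbrt (TammRubilar.det κ p)) • κ p) ∧
      ∀ p : N, TammRubilar.fresnel (TammRubilar.inv κ) p = TammRubilar.fresnel κ p) := by
  open TammRubilar in
  refine ⟨fun f _ => ?_, fun σ hσ => ?_, fun f _ => ?_, fun h => ⟨?_, fun p => ?_⟩⟩
  · funext φ p i j k l
    exact G_smul f κ φ p i j k l
  · funext φ p i j k l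
    -- Vanishing is proportionality of σ to itself with factor 0.
    rw [G_eq_mul_of_det_offBlock σ σ p 0 (fun b => by
      rw [det_offBlock_of_skew b (σ p) (hσ.1.2 p), mul_zero]) φ p.2, zero_mul]
    rfl
  · funext φ p i j k l
    rw [G_eq_mul_of_det_offBlock κ (fun q => κ q + f q • 1) p 1 (fun b => by
      rw [offBlock_add_smul_one, one_mul]) φ p.2, one_mul]
  · funext φ p i j k l
    -- Both sides equal -(det κ)⁻¹ times the density of κ, as the cube of -(det κ)^(-1/3) shows.
    rw [G_inv κ h, G_smul (fun q => -invCbrt (det κ q)), Odd.neg_pow (by decide),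
      invCbrt_pow_three _ (det_ne_zero κ h p)]
  · have hd := det_ne_zero κ h p
    ext ξ
    refine forall_congr' fun φ => forall_congr' fun hp => ?_
    -- The two quartics differ by the nonzero factor -(det κ)⁻¹.
    simp only [G_inv κ h, mul_assoc, ← Finset.mul_sum]
    simp [hd]
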